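/- Let $f(n)$, $n\ge1$, be a sequence of complex numbers, let $\kappa_0\in\mathbb{R}\setminus\{0\}$ and $\kappa\in\mathbb{C}$ with $\operatorname{Re}\kappa>\kappa_0>-1$, let $\delta>0$ and $q>1$ be real numbers with $\delta\le\pi/\log q$ and $\delta<\operatorname{Re}\kappa-\kappa_0$, and let $m$ be a positive integer. Put $\chi_\ell=\frac{2\ell\pi i}{\log q}$ for $\ell\in\mathbb{Z}$, and write $\{x\}=x-\lfloor x\rfloor$. For $0\le k<m$ let $\Phi_k\colon\mathbb{R}\to\mathbb{C}$ be $1$-periodic and Hölder continuous with exponent $\alpha$, where $\operatorname{Re}\kappa-\kappa_0<\alpha\le1$, such that $$F(N):=\sum_{1\le n<N}f(n)=\sum_{0\le k<m}N^{\kappa}(\log_q N)^k\,\Phi_k(\{\log_q N\})+O(N^{\kappa_0})$$ for integers $N\to\infty$. For the Dirichlet series $\mathcal{F}(s):=\sum_{n\ge1}n^{-s}f(n)$ assume that - there is a real number $\sigma_a\ge\operatorname{Re}\kappa$ such that $\mathcal{F}(s)$ converges absolutely for $\operatorname{Re}s>\sigma_a$; - $\mathcal{F}(s)$ can be continued to a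 meromorphic function for $\operatorname{Re}s>\kappa_0-\delta$ (again denoted by $\mathcal{F}$) such that poles can only occur at $\kappa+\chi_\ell$ for $\ell\in\mathbb{Z}$ and these poles have order at most $m$; - there is a real number $\eta>0$ such that, for $\kappa_0\le\operatorname{Re}s\le\sigma_a$ and $|s-\kappa-\chi_\ell|\ge\delta$ for all $\ell\in\mathbb{Z}$, we have $\mathcal{F}(s)=O(|\operatorname{Im}s|^{\eta})$ uniformly as $|\operatorname{Im}s|\to\infty$. Then, for $0\le k<m$, the function $\Phi_k$ is the sum of its pointwise (as a limit of symmetric partial sums) convergent Fourier series, $$\Phi_k(u)=\sum_{\ell\in\mathbb{Z}}\varphi_{k\ell}\exp(2\ell\pi i u)\qquad(u\in\mathbb{R}),$$ whose Fourier coefficients $\varphi_{k\ell}=\int_0^1\Phi_k(u)\exp(-2\ell\pi i u)\,du$ are given by $$\varphi_{k\ell}=\frac{(\log q)^k}{k!}\operatorname{Res}_{s=\kappa+\chi_\ell}\left(\frac{\mathcal{F}(s)(s-\kappa-\chi_\ell)^k}{s}\right)\qquad(\ell\in\mathbb{Z}).$$ Moreover, if $-1<\kappa_0<0$ and $\kappa\notin\frac{2\pi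 i}{\log q}\mathbb{Z}$, then $\mathcal{F}(0)=0$. -/

import Mathlib

/-- The points `χ_ℓ = 2 ℓ π i / log q`. -/
noncomputable def chi (q : ℝ) (l : ℤ) : ℂ :=
  2 * (l : ℂ) * (Real.pi : ℂ) * Complex.I / (Real.log q : ℂ)

/-- The residue of `g` at `a`: the integral `(2 π i)⁻¹ ∮ g(s) ds` over the circle of radius `r`
about `a`, for small `r > 0`. At an isolated singularity it does not depend on the small radius,
so that the limit is its eventual value. -/
noncomputable def residue (g : ℂ → ℂ) (a : ℂ) : ℂ :=
  Filter.limUnder (nhdsWithin (0 : ℝ) (Set.Ioi 0))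
    (fun r : ℝ => (2 * (Real.pi : ℂ) * Complex.I)⁻¹ * circleIntegral g a r)

/-- The coefficients `φ_{kℓ} = (log q)^k / k! · Res_{s = κ + χ_ℓ} 𝓕(s) (s - κ - χ_ℓ)^k / s`. -/
noncomputable def fluctuationCoeff (𝓕 : ℂ → ℂ) (q : ℝ) (κ : ℂ) (k : ℕ) (l : ℤ) : ℂ :=
  ((Real.log q : ℂ) ^ k / (k.factorial : ℂ)) *
    residue (fun s : ℂ => 𝓕 s * (s - κ - chi q l) ^ k / s) (κ + chi q l)

open Complex Filter Topology MeasureTheory Set Asymptotics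

/-! By partial summation `𝓕 s / s` is, far to the right, the Mellin transform at `-s` of the
summatory function on `x > 1`. Insert the asymptotic expansion. Hölder continuity with `α > Re κ -
κ₀` carries it from integers to real `x` with the same error `O(x^κ₀)` (`isBigO_summatoryError`),
and the Mellin transform of that error is analytic for `Re s > κ₀`.

In a main term, scaling by `q` only shifts the argument of `Φ_k` by a period. With `w = κ - s`, the
transform of `Φ_k(log_q x)` is therefore `P_k(w) / (1 - q^w)`, with `P_k` the entire transform over
one period; each factor `log x` is one derivative in `w`. At `w = -χ_ℓ` the `k`-th derivative has
the pure principal part `const · (w + χ_ℓ)^(-k-1)`, so different `k` do not mix, and the constant is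
a multiple of `P_k(-χ_ℓ)`, which is `log q` times the `ℓ`-th Fourier coefficient of `Φ_k`. The
identity theorem (`eventually_eq_mul_quotientExt`) carries the formula to `Re s > κ₀`, and the
residues give the coefficients (`fluctuationCoeff_eq_integral`).

Pointwise convergence uses only the Hölder condition (`tendsto_fourier_of_holder`). Finally `𝓕 s = s
* quotientExt … s`, whose second factor is analytic at `0` under the extra assumptions; hence `𝓕 0 =
0`. -/

/-! ### Residues from principal parts. -/

/-- The factor `(s - a)^k` shifts the Laurent exponents, so only `j = k` has exponent `-1`; all
other integer powers integrate to zero over a circle. -/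
theorem residue_eq_of_principal_part {g h : ℂ → ℂ} {a : ℂ} {m k : ℕ} (hk : k < m) (b : ℕ → ℂ)
    (hh : AnalyticAt ℂ h a)
    (hg : g =ᶠ[𝓝[≠] a] fun s => (s - a) ^ k *
      (h s + ∑ j ∈ Finset.range m, b j * ((s - a) ^ (j + 1))⁻¹)) :
    residue g a = b k := by
  have hpi : (2 * (Real.pi : ℂ) * I) ≠ 0 := by simp [Real.pi_ne_zero]
  obtain ⟨r₀, hr₀, H⟩ := Metric.eventually_nhds_iff_ball.1
    ((eventually_nhdsWithin_iff.1 hg).and hh.eventually_analyticAt)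
  refine Tendsto.limUnder_eq (tendsto_const_nhds.congr' ?_)
  filter_upwards [Ioo_mem_nhdsGT hr₀] with r hr
  have hsub : Metric.closedBall a r ⊆ Metric.ball a r₀ := Metric.closedBall_subset_ball hr.2
  have hne : ∀ s ∈ Metric.sphere a r, s - a ≠ 0 := fun s hs h0 => by
    rw [mem_sphere_iff_norm, h0, norm_zero] at hs
    exact hr.1.ne hs
  have h1 : circleIntegral g a r = circleIntegral (fun s => (s - a) ^ k * h s +
      ∑ j ∈ Finset.range m, b j * (s - a) ^ ((k : ℤ) - (j + 1 : ℤ))) a r := by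
    refine circleIntegral.integral_congr hr.1.le fun s hs => ?_
    have hs0 := hne s hs
    rw [(H s (hsub (Metric.sphere_subset_closedBall hs))).1 (by
      simpa [sub_eq_zero] using hs0)]
    beta_reduce
    rw [mul_add, Finset.mul_sum]
    congr 1
    refine Finset.sum_congr rfl fun j _ => ?_
    rw [zpow_sub₀ hs0, zpow_natCast, ← Nat.cast_succ, zpow_natCast]
    field_simp
  have hcont : ContinuousOn (fun s => (s - a) ^ k * h s) (Metric.closedBall a r) := fun s hs =>
    (((continuousAt_id.sub continuousAt_const).pow k).mul
      (H s (hsub hs)).2.continuousAt).continuousWithinAt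
  have hci : ∀ j ∈ Finset.range m, CircleIntegrable
      (fun s => b j * (s - a) ^ ((k : ℤ) - (j + 1 : ℤ))) a r := fun j _ =>
    ContinuousOn.circleIntegrable hr.1.le fun s hs =>
      (continuousAt_const.mul ((continuousAt_id.sub continuousAt_const).zpow₀ _
        (Or.inl (hne s hs)))).continuousWithinAt
  have h2 : circleIntegral (fun s => (s - a) ^ k * h s) a r = 0 := by
    refine circleIntegral_eq_zero_of_differentiable_on_off_countable hr.1.le countable_empty
      hcont fun s hs => ?_
    have := (H s (hsub (Metric.ball_subset_closedBall hs.1))).2.differentiableAt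
    fun_prop
  rw [h1, circleIntegral.integral_add ((hcont.mono Metric.sphere_subset_closedBall).circleIntegrable
    hr.1.le) (CircleIntegrable.fun_sum _ hci), h2, zero_add, circleIntegral.integral_fun_sum hci,
    Finset.sum_eq_single k]
  · have : (fun s : ℂ => b k * (s - a) ^ ((k : ℤ) - (k + 1 : ℤ))) =
        fun s => b k * (s - a)⁻¹ := by
      ext s; simp
    rw [this, circleIntegral.integral_const_mul,
      circleIntegral.integral_sub_center_inv a hr.1.ne']
    field_simp
  · intro j _ hj
    rw [circleIntegral.integral_const_mul, circleIntegral.integral_sub_zpow_of_ne (by omega),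
      mul_zero]
  · exact fun h => absurd (Finset.mem_range.2 hk) h

/-! ### Pointwise convergence of Fourier series of Hölder functions. -/

theorem sum_Icc_neg_telescope (g : ℤ → ℂ) (L : ℕ) :
    ∑ l ∈ Finset.Icc (-(L : ℤ)) L, (g (l - 1) - g l) = g (-(L : ℤ) - 1) - g L := by
  induction L with
  | zero => simp
  | succ n ih =>
    have : Finset.Icc (-((n + 1 : ℕ) : ℤ)) ((n + 1 : ℕ) : ℤ) =
        insert (-(n : ℤ) - 1) (insert ((n : ℤ) + 1) (Finset.Icc (-(n : ℤ)) n)) := by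
      ext x; simp only [Finset.mem_Icc, Finset.mem_insert]; omega
    rw [this, Finset.sum_insert, Finset.sum_insert, ih]
    · push_cast; ring_nf
    · simp
    · simp only [Finset.mem_Icc, Finset.mem_insert]; omega

/-- Riemann–Lebesgue for `h` cut off to `(a, b]`. Integrability is not needed: otherwise every
integral is zero by convention. -/
theorem tendsto_fourier_coeff_zero (h : ℝ → ℂ) (a b : ℝ) (hab : a ≤ b) {x : ℕ → ℤ}
    (hx : Tendsto (fun L => |(x L : ℝ)|) atTop atTop) :
    Tendsto (fun L => ∫ v in a..b, h v * exp (-(2 * (x L : ℂ) * (Real.pi : ℂ) * I * (v : ℂ))))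
      atTop (𝓝 0) := by
  have H := (Real.tendsto_integral_exp_smul_cocompact (indicator (Ioc a b) h)).comp
    (f := fun L => (x L : ℝ)) (x := atTop)
    (by rw [← Metric.cobounded_eq_cocompact, ← comap_norm_atTop]; exact tendsto_comap_iff.2 hx)
  refine H.congr fun L => ?_
  rw [intervalIntegral.integral_of_le hab, ← integral_indicator measurableSet_Ioc]
  simp only [Function.comp]
  congr 1; ext v
  by_cases hv : v ∈ Ioc a b
  · simp only [indicator_of_mem hv]
    rw [Circle.smul_def, Real.fourierChar_apply, smul_eq_mul, mul_comm]
    congr 2; push_cast; ring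
  · simp [indicator_of_notMem hv]

theorem norm_le_of_holder {Φ : ℝ → ℂ} {C α : NNReal} (h : HolderWith C α Φ) (x y : ℝ) :
    ‖Φ x - Φ y‖ ≤ C * |x - y| ^ (α : ℝ) := by
  simpa [dist_eq_norm, Real.dist_eq] using h.dist_le x y

/-- Jordan's inequality for the sine, since `|exp(iθ) - 1| = 2 |sin(θ/2)|`. -/
theorem four_mul_abs_le_norm_exp_sub_one {v : ℝ} (hv : |v| ≤ 1 / 2) :
    4 * |v| ≤ ‖exp (2 * (Real.pi : ℂ) * I * (v : ℂ)) - 1‖ := by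
  have e1 : (2 * (Real.pi : ℂ) * I * (v : ℂ)) = I * ((2 * Real.pi * v : ℝ) : ℂ) := by
    push_cast; ring
  rw [e1, Complex.norm_exp_I_mul_ofReal_sub_one]
  have := Real.mul_abs_le_abs_sin (x := Real.pi * v) (by
    rw [abs_mul, abs_of_pos Real.pi_pos]; nlinarith [Real.pi_pos])
  rw [abs_mul, abs_of_pos Real.pi_pos] at this
  have e2 : 2 / Real.pi * (Real.pi * |v|) = 2 * |v| := by field_simp
  rw [e2] at this
  rw [show 2 * Real.pi * v / 2 = Real.pi * v by ring, norm_mul, Real.norm_eq_abs, Real.norm_eq_abs,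
    abs_two]
  linarith

theorem integral_exp_int (l : ℤ) :
    ∫ v in (-(1 / 2) : ℝ)..(1 / 2), exp (-(2 * (l : ℂ) * (Real.pi : ℂ) * I * (v : ℂ))) =
      if l = 0 then 1 else 0 := by
  split_ifs with h
  · subst h; norm_num
  · have hc : -(2 * (l : ℂ) * (Real.pi : ℂ) * I) ≠ 0 := by simp [Real.pi_ne_zero, h]
    have := integral_exp_mul_complex (a := -(1 / 2)) (b := 1 / 2) hc
    simp only [← neg_mul] at this ⊢
    rw [this, div_eq_zero_iff]
    left
    rw [sub_eq_zero, Complex.exp_eq_exp_iff_exists_int]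
    exact ⟨-l, by push_cast; ring⟩

theorem intervalIntegrable_abs_rpow {β : ℝ} (hβ : -1 < β) (a b : ℝ) :
    IntervalIntegrable (fun x : ℝ => |x| ^ β) volume a b := by
  have pos : ∀ b : ℝ, 0 ≤ b → IntervalIntegrable (fun x : ℝ => |x| ^ β) volume 0 b := fun b hb =>
    (intervalIntegral.intervalIntegrable_rpow' hβ).congr fun x hx => by
      rw [uIoc_of_le hb] at hx
      simp only [abs_of_pos hx.1]
  have all : ∀ b : ℝ, IntervalIntegrable (fun x : ℝ => |x| ^ β) volume 0 b := fun b => by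
    rcases le_total 0 b with hb | hb
    · exact pos b hb
    · have := (IntervalIntegrable.iff_comp_neg (f := fun x : ℝ => |x| ^ β)).1 (pos (-b) (by linarith))
      simpa using this
  exact (all a).symm.trans (all b)

/-- Chernoff's argument: dividing `Φ(v + u) - Φ(u)` by `exp(2πiv) - 1` leaves an integrable
function, and turns each Fourier term into a difference of consecutive coefficients of the quotient.
Symmetric sums telescope to two boundary coefficients, which vanish by Riemann–Lebesgue. -/
theorem tendsto_fourier_of_holder {Φ : ℝ → ℂ} (hper : Function.Periodic Φ 1) {C α : NNReal}
    (hα : 0 < α) (h : HolderWith C α Φ) (u : ℝ) :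
    Tendsto (fun L : ℕ => ∑ l ∈ Finset.Icc (-(L : ℤ)) (L : ℤ),
      (∫ v in (0 : ℝ)..1, Φ v * exp (-(2 * (l : ℂ) * (Real.pi : ℂ) * I * (v : ℂ)))) *
        exp (2 * (l : ℂ) * (Real.pi : ℂ) * I * (u : ℂ))) atTop (𝓝 (Φ u)) := by
  have hΦc : Continuous Φ := h.continuous hα
  set E : ℝ → ℂ := fun v => exp (2 * (Real.pi : ℂ) * I * (v : ℂ)) - 1 with hE
  set e : ℤ → ℝ → ℂ := fun l v => exp (-(2 * (l : ℂ) * (Real.pi : ℂ) * I * (v : ℂ))) with he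
  set g : ℝ → ℂ := fun v => Φ (v + u) - Φ u with hg
  have hec : ∀ l, Continuous (e l) := fun l => by fun_prop
  have hE0 : ∀ v ∈ Icc (-(1 / 2) : ℝ) (1 / 2), g v = g v / E v * E v := fun v hv => by
    have h4 := four_mul_abs_le_norm_exp_sub_one (abs_le.2 hv)
    rcases eq_or_ne v 0 with rfl | hv0
    · simp [hg]
    · have : E v ≠ 0 := norm_pos_iff.1 (lt_of_lt_of_le (by positivity) h4)
      field_simp
  -- The quotient is at most `C |v|^α / (4 |v|)`, and `α - 1 > -1`.
  have hint : IntervalIntegrable (fun v => g v / E v) volume (-(1 / 2)) (1 / 2) := by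
    refine ((intervalIntegrable_abs_rpow (β := (α : ℝ) - 1) (by
      have : (0 : ℝ) < α := hα
      linarith) _ _).const_mul (C : ℝ)).mono_fun ?_ ?_
    · refine Measurable.aestronglyMeasurable ?_
      have : Measurable g := by fun_prop
      have : Measurable E := by fun_prop
      fun_prop
    · refine (ae_restrict_iff' measurableSet_uIoc).2 (Eventually.of_forall fun v hv => ?_)
      rw [uIoc_of_le (by norm_num)] at hv
      rcases eq_or_ne v 0 with rfl | hv0
      · simp [hg]; positivity
      have hv' : 0 < |v| := abs_pos.2 hv0
      have h4 := four_mul_abs_le_norm_exp_sub_one (abs_le.2 ⟨hv.1.le, hv.2⟩)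
      have h5 : ‖g v‖ ≤ C * |v| ^ (α : ℝ) := by simpa [hg] using norm_le_of_holder h (v + u) u
      beta_reduce
      rw [norm_div, Real.norm_of_nonneg (by positivity), Real.rpow_sub_one hv'.ne',
        ← mul_div_assoc]
      exact div_le_div₀ (by positivity) h5 hv' (by linarith)
  have hint' : ∀ l, IntervalIntegrable (fun v => g v / E v * e l v) volume (-(1 / 2)) (1 / 2) :=
    fun l => hint.mul_continuousOn (hec l).continuousOn
  have key : ∀ l : ℤ, (∫ v in (0 : ℝ)..1, Φ v * e l v) *
        exp (2 * (l : ℂ) * (Real.pi : ℂ) * I * (u : ℂ)) =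
      ((∫ v in (-(1 / 2) : ℝ)..(1 / 2), g v / E v * e (l - 1) v) -
        ∫ v in (-(1 / 2) : ℝ)..(1 / 2), g v / E v * e l v) + if l = 0 then Φ u else 0 := by
    intro l
    have hp : Function.Periodic (fun v => Φ v * e l (v - u)) 1 := fun v => by
      simp only [he]
      rw [hper v]
      congr 1
      rw [Complex.exp_eq_exp_iff_exists_int]
      exact ⟨-l, by push_cast; ring⟩
    have h1 : (∫ v in (0 : ℝ)..1, Φ v * e l v) * exp (2 * (l : ℂ) * (Real.pi : ℂ) * I * (u : ℂ)) =
        ∫ v in (0 : ℝ)..1, Φ v * e l (v - u) := by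
      rw [← intervalIntegral.integral_mul_const]
      congr 1; ext v
      simp only [he]
      rw [mul_assoc, ← Complex.exp_add]
      congr 2; push_cast; ring
    have h2 : ∫ v in (0 : ℝ)..1, Φ v * e l (v - u) =
        ∫ v in (-(1 / 2) : ℝ)..(1 / 2), Φ (v + u) * e l v := by
      have := hp.intervalIntegral_add_eq 0 (-(1 / 2) + u)
      rw [zero_add] at this
      rw [this, show -(1 / 2) + u + 1 = 1 / 2 + u by ring,
        ← intervalIntegral.integral_comp_add_right]
      simp
    have h3 : ∫ v in (-(1 / 2) : ℝ)..(1 / 2), Φ (v + u) * e l v =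
        ∫ v in (-(1 / 2) : ℝ)..(1 / 2),
          (g v / E v * e (l - 1) v - g v / E v * e l v) + Φ u * e l v := by
      refine intervalIntegral.integral_congr fun v hv => ?_
      rw [uIcc_of_le (by norm_num)] at hv
      -- Multiplication by `exp(2πiv)` lowers the frequency index by one, so multiplying by `E` is
      -- taking a difference.
      have h4 : e (l - 1) v = (E v + 1) * e l v := by
        simp only [he, hE]
        rw [sub_add_cancel, ← Complex.exp_add]
        congr 1; push_cast; ring
      have h5 : Φ (v + u) = g v / E v * E v + Φ u := by
        rw [← hE0 v hv]; simp [hg]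
      rw [h4, h5]; ring
    have hc : IntervalIntegrable (fun v => Φ u * e l v) volume (-(1 / 2)) (1 / 2) :=
      (continuous_const.mul (hec l)).intervalIntegrable _ _
    rw [h1, h2, h3, intervalIntegral.integral_add ((hint' _).sub (hint' _)) hc,
      intervalIntegral.integral_sub (hint' _) (hint' _), intervalIntegral.integral_const_mul,
      integral_exp_int]
    simp
  have hlim : Tendsto (fun L : ℕ =>
      ((∫ v in (-(1 / 2) : ℝ)..(1 / 2), g v / E v * e (-(L : ℤ) - 1) v) -
        ∫ v in (-(1 / 2) : ℝ)..(1 / 2), g v / E v * e (L : ℤ) v) + Φ u) atTop (𝓝 (Φ u)) := by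
    have t1 := tendsto_fourier_coeff_zero (fun v => g v / E v) (-(1 / 2)) (1 / 2) (by norm_num)
      (x := fun L : ℕ => -(L : ℤ) - 1) (by
        refine tendsto_atTop_mono (fun L => ?_) tendsto_natCast_atTop_atTop
        push_cast
        rw [show (-(L : ℝ) - 1) = -(L + 1) by ring, abs_neg]
        exact le_trans (by linarith) (le_abs_self _))
    have t2 := tendsto_fourier_coeff_zero (fun v => g v / E v) (-(1 / 2)) (1 / 2) (by norm_num)
      (x := fun L : ℕ => (L : ℤ)) (by
        refine tendsto_atTop_mono (fun L => ?_) tendsto_natCast_atTop_atTop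
        push_cast
        exact le_abs_self _)
    simpa [he] using (t1.sub t2).add_const (Φ u)
  refine hlim.congr fun L => ?_
  rw [Finset.sum_congr rfl fun l _ => key l, Finset.sum_add_distrib,
    sum_Icc_neg_telescope (fun l => ∫ v in (-(1 / 2) : ℝ)..(1 / 2), g v / E v * e l v)]
  simp

/-! ### Mellin transforms of functions supported on `x > 1`. -/

theorem locallyIntegrableOn_indicator_Ioi_one {g : ℝ → ℂ} (hg : LocallyIntegrableOn g (Ici 1))
    (s : Set ℝ) : LocallyIntegrableOn (indicator (Ioi 1) g) s := by
  refine LocallyIntegrable.locallyIntegrableOn ?_ s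
  rw [locallyIntegrable_iff]
  intro K hK
  rw [IntegrableOn, integrable_indicator_iff measurableSet_Ioi, IntegrableOn,
    Measure.restrict_restrict measurableSet_Ioi]
  refine IntegrableOn.mono_set (hg.integrableOn_compact_subset (t := Ici 1 ∩ K)
    inter_subset_left (hK.inter_left isClosed_Ici)) (inter_subset_inter_left _ Ioi_subset_Ici_self)

theorem isBigO_indicator_Ioi_one_nhdsGT_zero (g : ℝ → ℂ) (h : ℝ → ℝ) :
    indicator (Ioi 1) g =O[𝓝[>] 0] h := by
  refine IsBigO.congr' (isBigO_zero h _) ?_ EventuallyEq.rfl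
  filter_upwards [Ioo_mem_nhdsGT zero_lt_one] with x hx
  exact (indicator_of_notMem (by simpa using hx.2.le) g).symm

theorem isBigO_indicator_Ioi_one_atTop {g : ℝ → ℂ} {h : ℝ → ℝ} (hg : g =O[atTop] h) :
    indicator (Ioi 1) g =O[atTop] h :=
  hg.congr' (by
    filter_upwards [eventually_gt_atTop 1] with x hx
    exact (indicator_of_mem hx g).symm) EventuallyEq.rfl

theorem mellin_indicator_Ioi_one {g : ℝ → ℂ} (hg : LocallyIntegrableOn g (Ici 1)) {c : ℝ}
    (hO : g =O[atTop] fun x : ℝ => x ^ c) {s : ℂ} (hs : s.re < -c) :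
    MellinConvergent (indicator (Ioi 1) g) s ∧
      HasDerivAt (mellin (indicator (Ioi 1) g))
        (mellin (indicator (Ioi 1) fun x => (Real.log x : ℂ) * g x) s) s := by
  have h1 := locallyIntegrableOn_indicator_Ioi_one hg (Ioi 0)
  have h2 : indicator (Ioi 1) g =O[atTop] fun x : ℝ => x ^ (-(-c)) := by
    simpa using isBigO_indicator_Ioi_one_atTop hO
  -- The function vanishes near `0`, so any exponent below `Re s` serves there.
  have h3 := isBigO_indicator_Ioi_one_nhdsGT_zero g (fun x => x ^ (-(s.re - 1)))
  refine ⟨mellinConvergent_of_isBigO_rpow h1 h2 hs h3 (by linarith), ?_⟩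
  have := (mellin_hasDerivAt_of_isBigO_rpow h1 h2 hs h3 (by linarith)).2
  have e : (indicator (Ioi 1) fun x => (Real.log x : ℂ) * g x) =
      fun t => Real.log t • indicator (Ioi 1) g t := by
    ext x
    by_cases hx : x ∈ Ioi (1 : ℝ)
    · simp [indicator_of_mem hx]
    · simp [indicator_of_notMem hx]
  rw [e]
  exact this

theorem exists_bound_of_periodic {Φ : ℝ → ℂ} (hper : Function.Periodic Φ 1)
    (hc : Continuous Φ) : ∃ M, ∀ x, ‖Φ x‖ ≤ M := by
  obtain ⟨M, hM⟩ := hper.isBounded_of_continuous one_ne_zero hc |>.exists_norm_le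
  exact ⟨M, fun x => hM _ (mem_range_self x)⟩

theorem isBigO_log_pow_mul {Φ : ℝ → ℂ} (hper : Function.Periodic Φ 1) (hc : Continuous Φ)
    (q : ℝ) (k : ℕ) {ε : ℝ} (hε : 0 < ε) :
    (fun x => (Real.log x : ℂ) ^ k * Φ (Real.logb q x)) =O[atTop] fun x : ℝ => x ^ ε := by
  obtain ⟨M, hM⟩ := exists_bound_of_periodic hper hc
  have h1 : (fun x : ℝ => (Real.log x : ℂ) ^ k) =O[atTop] fun x : ℝ => x ^ ε := by
    have := (isLittleO_log_rpow_rpow_atTop (k : ℝ) hε).isBigO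
    refine IsBigO.trans (IsBigO.of_norm_right (IsBigO.of_norm_le fun x => ?_)) this
    rw [norm_pow, Complex.norm_real, Real.rpow_natCast, norm_pow]
  have h2 : (fun x => Φ (Real.logb q x)) =O[atTop] fun _ : ℝ => (1 : ℝ) :=
    IsBigO.of_bound M (Eventually.of_forall fun x => by simpa using hM _)
  simpa using h1.mul h2

theorem continuousOn_log_pow_mul {Φ : ℝ → ℂ} (hc : Continuous Φ) (q : ℝ) (k : ℕ) :
    ContinuousOn (fun x => (Real.log x : ℂ) ^ k * Φ (Real.logb q x)) (Ici 1) := by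
  have hl : ContinuousOn Real.log (Ici 1) :=
    Real.continuousOn_log.mono fun x hx => (zero_lt_one.trans_le hx).ne'
  exact ((continuous_ofReal.comp_continuousOn hl).pow k).mul
    (hc.comp_continuousOn (hl.div_const _))

/-! ### Log-periodic functions: Mellin transform, continuation and poles. -/

/-- The Mellin transform of `(log x)^k Φ(log_q x)`, restricted to `x > 1`. -/
noncomputable def periodicMellin (q : ℝ) (Φ : ℝ → ℂ) (k : ℕ) : ℂ → ℂ :=
  mellin (indicator (Ioi 1) fun x => (Real.log x : ℂ) ^ k * Φ (Real.logb q x))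

/-- The Mellin transform of `Φ(log_q x)`, restricted to the fundamental domain `1 < x ≤ q`. -/
noncomputable def periodMellin (q : ℝ) (Φ : ℝ → ℂ) : ℂ → ℂ :=
  mellin (indicator (Ioi 1) (indicator (Iic q) fun x => Φ (Real.logb q x)))

/-- The meromorphic continuation of `periodicMellin q Φ k` to the whole plane. -/
noncomputable def periodicMellinExt (q : ℝ) (Φ : ℝ → ℂ) (k : ℕ) : ℂ → ℂ :=
  deriv^[k] fun w => periodMellin q Φ w / (1 - (q : ℂ) ^ w)

section
variable {q : ℝ} {Φ : ℝ → ℂ}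

theorem mellinConvergent_log_pow_mul (hper : Function.Periodic Φ 1) (hc : Continuous Φ) (k : ℕ)
    {w : ℂ} (hw : w.re < 0) :
    MellinConvergent (indicator (Ioi 1) fun x => (Real.log x : ℂ) ^ k * Φ (Real.logb q x)) w :=
  (mellin_indicator_Ioi_one
    ((continuousOn_log_pow_mul hc q k).locallyIntegrableOn measurableSet_Ici)
    -- Half of the available margin `-Re w` absorbs the logarithms.
    (isBigO_log_pow_mul hper hc q k (ε := -w.re / 2) (by linarith)) (by linarith)).1

theorem hasDerivAt_periodicMellin (hper : Function.Periodic Φ 1) (hc : Continuous Φ) (k : ℕ)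
    {w : ℂ} (hw : w.re < 0) :
    HasDerivAt (periodicMellin q Φ k) (periodicMellin q Φ (k + 1) w) w := by
  have := (mellin_indicator_Ioi_one
    ((continuousOn_log_pow_mul hc q k).locallyIntegrableOn measurableSet_Ici)
    (isBigO_log_pow_mul hper hc q k (ε := -w.re / 2) (by linarith)) (s := w) (by linarith)).2
  simpa only [periodicMellin, pow_succ', mul_assoc] using this

/-- The integrand also vanishes beyond `q`, so the growth exponent can be chosen to suit any `w`. -/
theorem mellin_periodMellin (hc : Continuous Φ) (w : ℂ) :
    MellinConvergent (indicator (Ioi 1) (indicator (Iic q) fun x => Φ (Real.logb q x))) w ∧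
      DifferentiableAt ℂ (periodMellin q Φ) w := by
  have h1 : LocallyIntegrableOn (indicator (Iic q) fun x => Φ (Real.logb q x)) (Ici 1) := by
    have := (continuousOn_log_pow_mul hc q 0).locallyIntegrableOn (μ := volume) measurableSet_Ici
    simp only [pow_zero, one_mul] at this
    intro x hx
    obtain ⟨t, ht, h⟩ := this x hx
    exact ⟨t, ht, h.indicator measurableSet_Iic⟩
  have h2 : (indicator (Iic q) fun x => Φ (Real.logb q x)) =O[atTop]
      fun x : ℝ => x ^ (-w.re - 1) := by
    refine IsBigO.congr' (isBigO_zero _ _) ?_ EventuallyEq.rfl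
    filter_upwards [eventually_gt_atTop q] with x hx
    exact (indicator_of_notMem (by simpa using hx) _).symm
  have := mellin_indicator_Ioi_one h1 h2 (s := w) (by linarith)
  exact ⟨this.1, this.2.differentiableAt⟩

/-- Split `x > 1` at `q`. By periodicity the part beyond `q` is the whole function dilated by `q`,
and dilation multiplies the transform by `q^w`. -/
theorem periodicMellin_zero_functional (hq : 1 < q) (hper : Function.Periodic Φ 1)
    (hc : Continuous Φ) {w : ℂ} (hw : w.re < 0) :
    periodicMellin q Φ 0 w * (1 - (q : ℂ) ^ w) = periodMellin q Φ w := by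
  have hq0 : 0 < q := by linarith
  set P : ℝ → ℂ := indicator (Ioi 1) fun x => (Real.log x : ℂ) ^ 0 * Φ (Real.logb q x) with hP
  have hconv := mellinConvergent_log_pow_mul (q := q) hper hc 0 hw
  have hconv' : MellinConvergent (fun x => P (q⁻¹ * x)) w :=
    (MellinConvergent.comp_mul_left (inv_pos.2 hq0)).2 hconv
  have h1 : P = fun x => indicator (Ioi 1) (indicator (Iic q) fun x => Φ (Real.logb q x)) x +
      P (q⁻¹ * x) := by
    ext x
    have hqx : q⁻¹ * x ∈ Ioi 1 ↔ x ∈ Ioi q := by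
      simp only [mem_Ioi]
      rw [inv_mul_eq_div, lt_div_iff₀ hq0, one_mul]
    by_cases hx1 : x ∈ Ioi (1 : ℝ)
    · by_cases hx2 : x ∈ Iic q
      · have : q⁻¹ * x ∉ Ioi 1 := by rw [hqx]; simpa using hx2
        simp [hP, indicator_of_mem hx1, indicator_of_mem hx2, indicator_of_notMem this]
      · have : q⁻¹ * x ∈ Ioi 1 := by rw [hqx]; simpa using hx2
        simp only [hP, indicator_of_mem hx1, indicator_of_notMem hx2, indicator_of_mem this,
          pow_zero, one_mul, zero_add]
        have hx0 : x ≠ 0 := (zero_lt_one.trans hx1).ne'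
        rw [Real.logb_mul (inv_ne_zero hq0.ne') hx0, Real.logb_inv,
          Real.logb_self_eq_one hq, neg_add_eq_sub, hper.sub_eq]
    · have : q⁻¹ * x ∉ Ioi 1 := by
        rw [hqx]
        simp only [mem_Ioi, not_lt] at hx1 ⊢
        linarith
      simp [hP, indicator_of_notMem hx1, indicator_of_notMem this]
  have h2 : mellin P w = periodMellin q Φ w + (q : ℂ) ^ w * mellin P w := by
    conv_lhs => rw [h1]
    rw [(hasMellin_add (mellin_periodMellin hc w).1 hconv').2, mellin_comp_mul_left _ _
      (inv_pos.2 hq0), smul_eq_mul]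
    congr 2
    rw [ofReal_inv, inv_cpow _ _ (by rw [arg_ofReal_of_nonneg hq0.le]; exact Real.pi_pos.ne),
      cpow_neg, inv_inv]
  change mellin P w * _ = _
  linear_combination h2

theorem norm_cpow_lt_one (hq : 1 < q) {w : ℂ} (hw : w.re < 0) : ‖(q : ℂ) ^ w‖ < 1 := by
  rw [norm_cpow_eq_rpow_re_of_pos (by linarith)]
  exact Real.rpow_lt_one_of_one_lt_of_neg hq hw

/-- Differentiating a Mellin transform inserts a factor `log x`; the induction differentiates an
equality valid on an open half-plane. -/
theorem periodicMellinExt_eq (hq : 1 < q) (hper : Function.Periodic Φ 1)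
    (hc : Continuous Φ) (k : ℕ) {w : ℂ} (hw : w.re < 0) :
    periodicMellinExt q Φ k w = periodicMellin q Φ k w := by
  induction k generalizing w with
  | zero =>
    rw [periodicMellinExt, Function.iterate_zero, id, ← periodicMellin_zero_functional hq hper hc hw]
    refine mul_div_cancel_right₀ _ (sub_ne_zero.2 fun h => ?_)
    have := norm_cpow_lt_one hq hw
    rw [← h, norm_one] at this
    exact this.false
  | succ k ih =>
    rw [periodicMellinExt, Function.iterate_succ_apply',
      ← (hasDerivAt_periodicMellin (q := q) hper hc k hw).deriv]
    refine EventuallyEq.deriv_eq ?_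
    filter_upwards [(isOpen_Iio.preimage continuous_re).mem_nhds hw] with z hz using ih hz

theorem hasDerivAt_const_cpow' (hq : 1 < q) (w : ℂ) :
    HasDerivAt (fun w => (q : ℂ) ^ w) ((q : ℂ) ^ w * Real.log q) w := by
  have hq0 : 0 < q := by linarith
  have := (hasDerivAt_id w).const_cpow (c := (q : ℂ))
    (Or.inl (by exact_mod_cast (by positivity : q ≠ 0)))
  simpa [ofReal_log hq0.le] using this

theorem differentiable_const_cpow (hq : 1 < q) : Differentiable ℂ fun w : ℂ => (q : ℂ) ^ w :=
  fun w => (hasDerivAt_const_cpow' hq w).differentiableAt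

theorem differentiable_periodMellin (hc : Continuous Φ) : Differentiable ℂ (periodMellin q Φ) :=
  fun w => (mellin_periodMellin hc w).2

theorem meromorphicAt_periodicMellinExt_zero (hq : 1 < q) (hc : Continuous Φ) (w : ℂ) :
    MeromorphicAt (fun w => periodMellin q Φ w / (1 - (q : ℂ) ^ w)) w := by
  have h1 := differentiable_periodMellin (q := q) hc
  have h2 := differentiable_const_cpow hq
  exact (h1.analyticAt w).meromorphicAt.div ((analyticAt_const.sub (h2.analyticAt w)).meromorphicAt)

theorem meromorphicAt_periodicMellinExt (hq : 1 < q) (hc : Continuous Φ) (k : ℕ) (w : ℂ) :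
    MeromorphicAt (periodicMellinExt q Φ k) w :=
  (meromorphicAt_periodicMellinExt_zero hq hc w).iterated_deriv

theorem periodicMellinExt_analyticAt (hq : 1 < q) (hc : Continuous Φ) (k : ℕ) {w : ℂ}
    (hw : (q : ℂ) ^ w ≠ 1) : AnalyticAt ℂ (periodicMellinExt q Φ k) w := by
  have h1 := differentiable_periodMellin (q := q) hc
  have h2 := differentiable_const_cpow hq
  exact ((h1.analyticAt w).div (analyticAt_const.sub (h2.analyticAt w))
    (sub_ne_zero.2 hw.symm)).iterated_deriv k

theorem AnalyticAt.dslope_self {f : ℂ → ℂ} {a : ℂ} (hf : AnalyticAt ℂ f a) :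
    AnalyticAt ℂ (dslope f a) a := by
  obtain ⟨p, hp⟩ := hf
  exact ⟨_, hp.has_fpower_series_dslope_fslope⟩

/-- The zero of `1 - q^w` at `w₀` is simple, with derivative `-log q`. One `dslope` divides it out;
a second splits off the value of the remaining quotient at `w₀`. -/
theorem periodicMellinExt_zero_principal_part (hq : 1 < q) (hc : Continuous Φ) {w₀ : ℂ}
    (hw : (q : ℂ) ^ w₀ = 1) : ∃ h : ℂ → ℂ, AnalyticAt ℂ h w₀ ∧
      periodicMellinExt q Φ 0 =ᶠ[𝓝[≠] w₀] fun w =>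
        -(periodMellin q Φ w₀ / Real.log q) * (w - w₀)⁻¹ + h w := by
  have hlog : (Real.log q : ℂ) ≠ 0 := by exact_mod_cast (Real.log_pos hq).ne'
  have h1 := differentiable_periodMellin (q := q) hc
  have h2 := differentiable_const_cpow hq
  have hd : HasDerivAt (fun w => 1 - (q : ℂ) ^ w) (-Real.log q : ℂ) w₀ := by
    simpa [hw] using (hasDerivAt_const_cpow' hq w₀).const_sub 1
  set E := dslope (fun w => 1 - (q : ℂ) ^ w) w₀ with hE
  have hEa : AnalyticAt ℂ E w₀ := (analyticAt_const.sub (h2.analyticAt w₀)).dslope_self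
  have hE0 : E w₀ = -Real.log q := by rw [hE, dslope_same, hd.deriv]
  set D := fun w => periodMellin q Φ w / E w with hD
  have hDa : AnalyticAt ℂ D w₀ := (h1.analyticAt w₀).div hEa (by simpa [hE0] using hlog)
  refine ⟨dslope D w₀, hDa.dslope_self, ?_⟩
  filter_upwards [self_mem_nhdsWithin] with w hww
  have hne : w - w₀ ≠ 0 := sub_ne_zero.2 hww
  have e1 : (1 - (q : ℂ) ^ w) = (w - w₀) * E w := by
    have := sub_smul_dslope (fun w => 1 - (q : ℂ) ^ w) w₀ w
    simp only [hw, sub_self, sub_zero, smul_eq_mul] at this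
    exact this.symm
  have e2 : D w = D w₀ + (w - w₀) * dslope D w₀ w := by
    have := sub_smul_dslope D w₀ w
    rw [smul_eq_mul] at this
    rw [this]; ring
  have e3 : -(periodMellin q Φ w₀ / Real.log q) = D w₀ := by
    simp only [hD, hE0, div_neg]
  rw [e3, periodicMellinExt, Function.iterate_zero, id, e1]
  have e4 : periodMellin q Φ w / ((w - w₀) * E w) = D w * (w - w₀)⁻¹ := by
    simp only [hD]
    rw [div_mul_eq_div_div_swap, div_eq_mul_inv]
  rw [e4, e2]
  field_simp

/-- Repeated differentiation of a simple pole produces a single power and no poles of lower order.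
-/
theorem periodicMellinExt_principal_part (hq : 1 < q) (hc : Continuous Φ) (k : ℕ) {w₀ : ℂ}
    (hw : (q : ℂ) ^ w₀ = 1) : ∃ h : ℂ → ℂ, AnalyticAt ℂ h w₀ ∧
      periodicMellinExt q Φ k =ᶠ[𝓝[≠] w₀] fun w =>
        -(periodMellin q Φ w₀ / Real.log q) * ((-1) ^ k * k.factorial) *
          ((w - w₀) ^ (k + 1))⁻¹ + h w := by
  induction k with
  | zero =>
    obtain ⟨h, ha, h⟩ := periodicMellinExt_zero_principal_part (Φ := Φ) hq hc hw
    exact ⟨_, ha, by simpa using h⟩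
  | succ k ih =>
    obtain ⟨h, ha, heq⟩ := ih
    refine ⟨deriv h, ha.deriv, ?_⟩
    have h1 : periodicMellinExt q Φ (k + 1) = deriv (periodicMellinExt q Φ k) := by
      rw [periodicMellinExt, Function.iterate_succ']; rfl
    rw [h1]
    filter_upwards [heq.nhdsNE_deriv, self_mem_nhdsWithin,
      nhdsWithin_le_nhds ha.eventually_analyticAt] with w e1 hww haw
    rw [e1]
    have hne : w - w₀ ≠ 0 := sub_ne_zero.2 hww
    have d1 : HasDerivAt (fun w => (w - w₀) ^ (k + 1)) (((k + 1 : ℕ) : ℂ) * (w - w₀) ^ k) w := by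
      simpa using! ((hasDerivAt_id w).sub_const w₀).fun_pow (k + 1)
    have d2 := ((d1.inv (pow_ne_zero _ hne)).const_mul
      (-(periodMellin q Φ w₀ / Real.log q) * ((-1) ^ k * k.factorial))).add
      haw.differentiableAt.hasDerivAt
    refine d2.deriv.trans ?_
    congr 1
    rw [Nat.factorial_succ]
    push_cast
    field_simp
    ring

/-- Substitute `x = q^u`. At `w = -χ_ℓ` the integral is a Fourier coefficient. -/
theorem periodMellin_eq_integral (hq : 1 < q) (hc : Continuous Φ) (w : ℂ) :
    periodMellin q Φ w = Real.log q * ∫ u in (0 : ℝ)..1, Φ u * exp (w * Real.log q * u) := by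
  have hq0 : 0 < q := by linarith
  have hlog := Real.log_pos hq
  have h1 : periodMellin q Φ w =
      ∫ x in (1 : ℝ)..q, (x : ℂ) ^ (w - 1) * Φ (Real.logb q x) := by
    rw [periodMellin, mellin, intervalIntegral.integral_of_le hq.le,
      ← integral_indicator measurableSet_Ioi, ← integral_indicator measurableSet_Ioc]
    congr 1; ext x
    simp only [indicator_apply, mem_Ioi, mem_Iic, mem_Ioc, smul_eq_mul]
    by_cases h1 : 1 < x
    · have : 0 < x := by linarith
      by_cases h2 : x ≤ q <;> simp [h1, h2, this]
    · simp [h1]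
  have hd : ∀ u : ℝ, HasDerivAt (fun u : ℝ => Real.exp (Real.log q * u))
      (Real.log q * Real.exp (Real.log q * u)) u := fun u => by
    have := ((hasDerivAt_id u).const_mul (Real.log q)).exp
    simpa [mul_comm] using this
  have h2 := intervalIntegral.integral_deriv_smul_comp' (a := 0) (b := 1)
    (f := fun u : ℝ => Real.exp (Real.log q * u))
    (f' := fun u : ℝ => Real.log q * Real.exp (Real.log q * u))
    (g := fun x : ℝ => (x : ℂ) ^ (w - 1) * Φ (Real.logb q x)) (fun u _ => hd u)
    (by fun_prop) (by
      rintro x ⟨u, -, rfl⟩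
      have hx := Real.exp_pos (Real.log q * u)
      refine ContinuousAt.continuousWithinAt (ContinuousAt.mul ?_ ?_)
      · exact continuousAt_ofReal_cpow_const _ _ (Or.inr hx.ne')
      · exact hc.continuousAt.comp ((Real.continuousAt_log hx.ne').div_const _))
  simp only [mul_zero, Real.exp_zero, mul_one, Real.exp_log hq0] at h2
  rw [h1, ← h2, ← intervalIntegral.integral_const_mul]
  congr 1; ext u
  have hx := Real.exp_pos (Real.log q * u)
  simp only [Function.comp]
  rw [Real.logb, Real.log_exp, mul_div_cancel_left₀ _ hlog.ne', real_smul,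
    cpow_def_of_ne_zero (by exact_mod_cast hx.ne'), ← ofReal_log hx.le, Real.log_exp]
  push_cast
  have : exp (w * Real.log q * u) =
      exp (Real.log q * u) * exp (Real.log q * u * (w - 1)) := by
    rw [← Complex.exp_add]; congr 1; ring
  rw [this]; ring

end

/-! ### From integers to a real variable in the asymptotic expansion. -/

theorem rpow_le_two_rpow_abs_mul {x y : ℝ} (hx : 1 ≤ x) (hxy : x ≤ y) (hy : y ≤ x + 1) (p : ℝ) :
    y ^ p ≤ 2 ^ |p| * x ^ p := by
  have hx0 : 0 < x := by linarith
  have h1 : 1 ≤ y / x := (one_le_div hx0).2 hxy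
  have h2 : y / x ≤ 2 := (div_le_iff₀ hx0).2 (by linarith)
  have h3 : (y / x) ^ p ≤ 2 ^ |p| :=
    (Real.rpow_le_rpow_of_exponent_le h1 (le_abs_self p)).trans
      (Real.rpow_le_rpow (by linarith) h2 (abs_nonneg p))
  rw [Real.div_rpow (by linarith) hx0.le, div_le_iff₀ (Real.rpow_pos_of_pos hx0 p)] at h3
  exact h3

theorem isBigO_sub_floor_add_one {g g' : ℝ → ℂ} {p : ℝ}
    (hd : ∀ x, 0 < x → HasDerivAt g (g' x) x) (hg : g' =O[atTop] fun x : ℝ => x ^ p) :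
    (fun x : ℝ => g ((⌊x⌋₊ + 1 : ℕ) : ℝ) - g x) =O[atTop] fun x : ℝ => x ^ p := by
  obtain ⟨c, hc, hb⟩ := hg.exists_nonneg
  obtain ⟨X, hX⟩ := eventually_atTop.1 hb.bound
  refine IsBigO.of_bound (c * 2 ^ |p|) ?_
  filter_upwards [eventually_ge_atTop (max X 1)] with x hx
  have hx1 : 1 ≤ x := (le_max_right _ _).trans hx
  have hN1 : x ≤ ((⌊x⌋₊ + 1 : ℕ) : ℝ) := by push_cast; exact (Nat.lt_floor_add_one x).le
  have hN2 : ((⌊x⌋₊ + 1 : ℕ) : ℝ) ≤ x + 1 := by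
    push_cast; linarith [Nat.floor_le (by linarith : 0 ≤ x)]
  have hxp : 0 ≤ x ^ p := Real.rpow_nonneg (by linarith) p
  have := (convex_Icc x (x + 1)).norm_image_sub_le_of_norm_hasDerivWithin_le
    (f := g) (f' := g') (C := c * 2 ^ |p| * x ^ p)
    (fun y hy => (hd y (by linarith [hy.1])).hasDerivWithinAt) (fun y hy => by
      have h1 := hX y (((le_max_left _ _).trans hx).trans hy.1)
      rw [Real.norm_of_nonneg (Real.rpow_nonneg (by linarith [hy.1]) p)] at h1
      rw [mul_assoc]
      exact h1.trans (mul_le_mul_of_nonneg_left (rpow_le_two_rpow_abs_mul hx1 hy.1 hy.2 p) hc))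
    ⟨le_rfl, by linarith⟩ ⟨hN1, hN2⟩
  refine this.trans ?_
  rw [Real.norm_of_nonneg hxp]
  refine mul_le_of_le_one_right (by positivity) ?_
  rw [Real.norm_eq_abs, abs_le]
  constructor <;> linarith

theorem isBigO_cpow_atTop (κ : ℂ) :
    (fun x : ℝ => (x : ℂ) ^ κ) =O[atTop] fun x : ℝ => x ^ κ.re := by
  refine IsBigO.of_bound 1 ?_
  filter_upwards [eventually_gt_atTop 0] with x hx
  rw [norm_cpow_eq_rpow_re_of_pos hx, one_mul]
  exact le_abs_self _

theorem isBigO_log_pow (k : ℕ) {ε : ℝ} (hε : 0 < ε) :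
    (fun x : ℝ => (Real.log x : ℂ) ^ k) =O[atTop] fun x : ℝ => x ^ ε := by
  simpa using isBigO_log_pow_mul (Φ := fun _ => 1) (fun _ => rfl) continuous_const 2 k hε

theorem isBigO_cpow_mul_rpow {κ : ℂ} {g : ℝ → ℂ} {b p : ℝ}
    (hg : g =O[atTop] fun x : ℝ => x ^ b) (hp : κ.re + b ≤ p) :
    (fun x : ℝ => (x : ℂ) ^ κ * g x) =O[atTop] fun x : ℝ => x ^ p := by
  refine ((isBigO_cpow_atTop κ).mul hg).trans (IsBigO.of_bound 1 ?_)
  filter_upwards [eventually_ge_atTop 1] with x hx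
  have hx0 : 0 < x := by linarith
  rw [← Real.rpow_add hx0, Real.norm_of_nonneg (Real.rpow_nonneg hx0.le _),
    Real.norm_of_nonneg (Real.rpow_nonneg hx0.le _), one_mul]
  exact Real.rpow_le_rpow_of_exponent_le hx hp

theorem isBigO_cpow_log_pow_sub_floor_add_one (κ : ℂ) (k : ℕ) {ε : ℝ} (hε : 0 < ε) :
    (fun x : ℝ => (((⌊x⌋₊ + 1 : ℕ) : ℝ) : ℂ) ^ κ * (Real.log ((⌊x⌋₊ + 1 : ℕ) : ℝ) : ℂ) ^ k -
      (x : ℂ) ^ κ * (Real.log x : ℂ) ^ k) =O[atTop] fun x : ℝ => x ^ (κ.re - 1 + ε) := by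
  refine isBigO_sub_floor_add_one (g := fun x : ℝ => (x : ℂ) ^ κ * (Real.log x : ℂ) ^ k)
    (g' := fun x : ℝ => (x : ℂ) ^ (κ - 1) *
      (κ * (Real.log x : ℂ) ^ k + k * (Real.log x : ℂ) ^ (k - 1))) ?_ ?_
  · intro x hx
    have hx0 : (x : ℂ) ≠ 0 := by exact_mod_cast hx.ne'
    have d1 : HasDerivAt (fun x : ℝ => (x : ℂ) ^ κ) (κ * (x : ℂ) ^ (κ - 1)) x := by
      have := ((hasDerivAt_id (x : ℂ)).cpow_const (c := κ) (Or.inl (by simpa using hx))).comp_ofReal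
      simpa using! this
    have d2 := ((Real.hasDerivAt_log hx.ne').ofReal_comp).fun_pow k
    refine (d1.fun_mul d2).congr_deriv ?_
    rw [cpow_sub _ _ hx0, cpow_one]
    push_cast
    field_simp
  · refine isBigO_cpow_mul_rpow (b := ε) ?_ (by simp)
    exact ((isBigO_log_pow k hε).const_mul_left κ).add
      ((isBigO_log_pow (k - 1) hε).const_mul_left (k : ℂ))

/-- Moving `x` by at most `1` moves `log_q x` by `O(1/x)`. -/
theorem isBigO_holder_logb_sub_floor_add_one {Φ : ℝ → ℂ} {C α : NNReal} (h : HolderWith C α Φ)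
    {q : ℝ} (hq : 1 < q) :
    (fun x : ℝ => Φ (Real.logb q ((⌊x⌋₊ + 1 : ℕ) : ℝ)) - Φ (Real.logb q x)) =O[atTop]
      fun x : ℝ => x ^ (-(α : ℝ)) := by
  have hlog := Real.log_pos hq
  refine IsBigO.of_bound (C * (1 / Real.log q) ^ (α : ℝ)) ?_
  filter_upwards [eventually_ge_atTop 1] with x hx
  have hx0 : 0 < x := by linarith
  have hN1 : x ≤ ((⌊x⌋₊ + 1 : ℕ) : ℝ) := by push_cast; exact (Nat.lt_floor_add_one x).le
  have hN2 : ((⌊x⌋₊ + 1 : ℕ) : ℝ) ≤ x + 1 := by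
    push_cast; linarith [Nat.floor_le hx0.le]
  set y : ℝ := ((⌊x⌋₊ + 1 : ℕ) : ℝ)
  have hy0 : 0 < y := by linarith
  have h1 : |Real.logb q y - Real.logb q x| ≤ 1 / Real.log q * x⁻¹ := by
    rw [← Real.logb_div hy0.ne' hx0.ne', Real.logb,
      abs_of_nonneg (div_nonneg (Real.log_nonneg ((one_le_div hx0).2 hN1)) hlog.le),
      div_eq_mul_inv, mul_comm, one_div]
    refine mul_le_mul_of_nonneg_left ?_ (inv_nonneg.2 hlog.le)
    refine (Real.log_le_sub_one_of_pos (div_pos hy0 hx0)).trans ?_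
    rw [div_sub_one hx0.ne', div_le_iff₀ hx0, inv_mul_cancel₀ hx0.ne']
    linarith
  rw [Real.norm_of_nonneg (Real.rpow_nonneg hx0.le _), mul_assoc, Real.rpow_neg hx0.le,
    ← Real.inv_rpow hx0.le, ← Real.mul_rpow (by positivity) (by positivity)]
  exact (norm_le_of_holder h _ _).trans (mul_le_mul_of_nonneg_left
    (Real.rpow_le_rpow (abs_nonneg _) h1 α.2) C.2)

theorem isBigO_term_sub_floor_add_one {Φ : ℝ → ℂ} (hper : Function.Periodic Φ 1) {C α : NNReal}
    (h : HolderWith C α Φ) {q : ℝ} (hq : 1 < q) {κ : ℂ} {κ₀ : ℝ} (hκ : κ₀ < κ.re)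
    (hα : κ.re - κ₀ < (α : ℝ)) (hα1 : α ≤ 1) (k : ℕ) :
    (fun x : ℝ => (((⌊x⌋₊ + 1 : ℕ) : ℝ) : ℂ) ^ κ * ((Real.log ((⌊x⌋₊ + 1 : ℕ) : ℝ) : ℂ) ^ k *
      Φ (Real.logb q ((⌊x⌋₊ + 1 : ℕ) : ℝ))) -
      (x : ℂ) ^ κ * ((Real.log x : ℂ) ^ k * Φ (Real.logb q x))) =O[atTop]
      fun x : ℝ => x ^ κ₀ := by
  have hα0 : 0 < α := by
    have : (0 : ℝ) < α := by linarith
    exact_mod_cast this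
  obtain ⟨M, hM⟩ := exists_bound_of_periodic hper (h.continuous hα0)
  have hα1' : (α : ℝ) ≤ 1 := by exact_mod_cast hα1
  -- The slack in the Hölder exponent pays for the logarithms: `Re κ + ε - α = κ₀`, and `Re κ - 1 +
  -- ε ≤ κ₀` because `α ≤ 1`.
  set ε : ℝ := α - (κ.re - κ₀) with hε
  have hε0 : 0 < ε := by linarith
  have t1 := (isBigO_cpow_log_pow_sub_floor_add_one κ k hε0).mul
    (IsBigO.of_bound M (Eventually.of_forall fun x => by simpa using hM _) :
      (fun x : ℝ => Φ (Real.logb q ((⌊x⌋₊ + 1 : ℕ) : ℝ))) =O[atTop] fun _ : ℝ => (1 : ℝ))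
  have t1' : (fun x : ℝ => x ^ (κ.re - 1 + ε) * (1 : ℝ)) =O[atTop] fun x : ℝ => x ^ κ₀ := by
    refine IsBigO.of_bound 1 ?_
    filter_upwards [eventually_ge_atTop 1] with x hx
    have hx0 : 0 < x := by linarith
    rw [mul_one, Real.norm_of_nonneg (Real.rpow_nonneg hx0.le _),
      Real.norm_of_nonneg (Real.rpow_nonneg hx0.le _), one_mul]
    exact Real.rpow_le_rpow_of_exponent_le hx (by linarith)
  have t2 : (fun x : ℝ => (x : ℂ) ^ κ * ((Real.log x : ℂ) ^ k *
      (Φ (Real.logb q ((⌊x⌋₊ + 1 : ℕ) : ℝ)) - Φ (Real.logb q x)))) =O[atTop]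
      fun x : ℝ => x ^ κ₀ := by
    refine isBigO_cpow_mul_rpow (b := ε + -(α : ℝ)) ?_ (by rw [hε]; linarith)
    refine ((isBigO_log_pow k hε0).mul (isBigO_holder_logb_sub_floor_add_one h hq)).congr'
      EventuallyEq.rfl ?_
    filter_upwards [eventually_gt_atTop 0] with x hx
    rw [Real.rpow_add hx]
  refine ((t1.trans t1').add t2).congr_left fun x => ?_
  ring

/-- The error term in the asymptotic expansion of the summatory function, as a function of a
real variable. -/
noncomputable def summatoryError (f : ℕ → ℂ) (κ : ℂ) (q : ℝ) (m : ℕ) (Φ : ℕ → ℝ → ℂ) (x : ℝ) : ℂ :=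
  (∑ n ∈ Finset.Icc 1 ⌊x⌋₊, f n) - ∑ k ∈ Finset.range m,
    ((Real.log q : ℂ) ^ k)⁻¹ * ((x : ℂ) ^ κ * ((Real.log x : ℂ) ^ k * Φ k (Real.logb q x)))

section
variable {f : ℕ → ℂ} {κ₀ : ℝ} {κ : ℂ} {q : ℝ} {m : ℕ} {Φ : ℕ → ℝ → ℂ}

theorem locallyIntegrableOn_sum_Icc_floor (f : ℕ → ℂ) :
    LocallyIntegrableOn (fun x : ℝ => ∑ n ∈ Finset.Icc 1 ⌊x⌋₊, f n) (Ici 1) := by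
  simpa using locallyIntegrableOn_mul_sum_Icc f (m := 1) zero_le_one
    (locallyIntegrableOn_const (1 : ℂ) (μ := volume) (s := Ici (1 : ℝ)))

theorem locallyIntegrableOn_summatoryError (hc : ∀ k < m, Continuous (Φ k)) :
    LocallyIntegrableOn (summatoryError f κ q m Φ) (Ici 1) := by
  refine (locallyIntegrableOn_sum_Icc_floor f).sub
    (ContinuousOn.locallyIntegrableOn ?_ measurableSet_Ici)
  refine continuousOn_finsetSum _ fun k hk => continuousOn_const.mul (ContinuousOn.mul ?_
    (continuousOn_log_pow_mul (hc k (Finset.mem_range.1 hk)) q k))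
  exact fun x hx => (continuousAt_ofReal_cpow_const _ _
    (Or.inr (zero_lt_one.trans_le hx).ne')).continuousWithinAt

/-- Take `N = ⌊x⌋ + 1`: the sum over `n < N` is then the sum over `n ≤ x`. It remains to replace `N`
by `x` in the main terms. -/
theorem isBigO_summatoryError (hq : 1 < q) (hκ : κ₀ < κ.re) {α : NNReal}
    (hα : κ.re - κ₀ < (α : ℝ)) (hα1 : α ≤ 1)
    (hΦper : ∀ k < m, Function.Periodic (Φ k) 1)
    (hΦhol : ∀ k < m, ∃ C : NNReal, HolderWith C α (Φ k))
    (hF : (fun N : ℕ => (∑ n ∈ Finset.Ico 1 N, f n) -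
        ∑ k ∈ Finset.range m, (N : ℂ) ^ κ * ((Real.logb q N : ℝ) : ℂ) ^ k *
          Φ k (Int.fract (Real.logb q N))) =O[atTop] (fun N : ℕ => (N : ℝ) ^ κ₀)) :
    summatoryError f κ q m Φ =O[atTop] fun x : ℝ => x ^ κ₀ := by
  have hN : Tendsto (fun x : ℝ => ⌊x⌋₊ + 1) atTop atTop :=
    (tendsto_add_atTop_nat 1).comp tendsto_nat_floor_atTop
  have h1 := hF.comp_tendsto hN
  have h2 : ((fun N : ℕ => (N : ℝ) ^ κ₀) ∘ fun x : ℝ => ⌊x⌋₊ + 1) =O[atTop]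
      fun x : ℝ => x ^ κ₀ := by
    refine IsBigO.of_bound (2 ^ |κ₀|) ?_
    filter_upwards [eventually_ge_atTop 1] with x hx
    have hN1 : x ≤ ((⌊x⌋₊ + 1 : ℕ) : ℝ) := by push_cast; exact (Nat.lt_floor_add_one x).le
    have hN2 : ((⌊x⌋₊ + 1 : ℕ) : ℝ) ≤ x + 1 := by
      push_cast; linarith [Nat.floor_le (by linarith : 0 ≤ x)]
    simp only [Function.comp]
    rw [Real.norm_of_nonneg (Real.rpow_nonneg (by linarith) _),
      Real.norm_of_nonneg (Real.rpow_nonneg (by linarith) _)]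
    exact rpow_le_two_rpow_abs_mul hx hN1 hN2 κ₀
  have h3 : (fun x : ℝ => ∑ k ∈ Finset.range m, ((Real.log q : ℂ) ^ k)⁻¹ *
      ((((⌊x⌋₊ + 1 : ℕ) : ℝ) : ℂ) ^ κ * ((Real.log ((⌊x⌋₊ + 1 : ℕ) : ℝ) : ℂ) ^ k *
      Φ k (Real.logb q ((⌊x⌋₊ + 1 : ℕ) : ℝ))) -
      (x : ℂ) ^ κ * ((Real.log x : ℂ) ^ k * Φ k (Real.logb q x)))) =O[atTop]
      fun x : ℝ => x ^ κ₀ := by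
    refine IsBigO.fun_sum fun k hk => IsBigO.const_mul_left ?_ _
    have hk := Finset.mem_range.1 hk
    obtain ⟨C, hC⟩ := hΦhol k hk
    exact isBigO_term_sub_floor_add_one (hΦper k hk) hC hq hκ hα hα1 k
  refine ((h1.trans h2).add h3).congr_left fun x => ?_
  have e1 : Finset.Ico 1 (⌊x⌋₊ + 1) = Finset.Icc 1 ⌊x⌋₊ := by ext; simp
  have e2 : ∀ k ∈ Finset.range m, ((⌊x⌋₊ + 1 : ℕ) : ℂ) ^ κ *
      ((Real.logb q ((⌊x⌋₊ + 1 : ℕ) : ℝ) : ℝ) : ℂ) ^ k *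
        Φ k (Int.fract (Real.logb q ((⌊x⌋₊ + 1 : ℕ) : ℝ))) = ((Real.log q : ℂ) ^ k)⁻¹ *
      ((((⌊x⌋₊ + 1 : ℕ) : ℝ) : ℂ) ^ κ * ((Real.log ((⌊x⌋₊ + 1 : ℕ) : ℝ) : ℂ) ^ k *
      Φ k (Real.logb q ((⌊x⌋₊ + 1 : ℕ) : ℝ)))) := fun k hk => by
    have : Φ k (Int.fract (Real.logb q ((⌊x⌋₊ + 1 : ℕ) : ℝ))) =
        Φ k (Real.logb q ((⌊x⌋₊ + 1 : ℕ) : ℝ)) := by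
      have := (hΦper k (Finset.mem_range.1 hk)).sub_int_mul_eq
        (x := Real.logb q ((⌊x⌋₊ + 1 : ℕ) : ℝ)) ⌊Real.logb q ((⌊x⌋₊ + 1 : ℕ) : ℝ)⌋
      rwa [mul_one] at this
    rw [this, Real.logb, ofReal_div, div_pow, ofReal_natCast]
    ring
  simp only [Function.comp, summatoryError, mul_sub, Finset.sum_sub_distrib]
  rw [e1, Finset.sum_congr rfl e2]
  ring

/-! ### Continuation of `𝓕 s / s` to `Re s > κ₀`. -/

theorem hasMellin_finset_sum {ι : Type*} (t : Finset ι) {g : ι → ℝ → ℂ} {s : ℂ}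
    (hg : ∀ i ∈ t, MellinConvergent (g i) s) :
    HasMellin (fun x => ∑ i ∈ t, g i x) s (∑ i ∈ t, mellin (g i) s) := by
  constructor
  · simpa only [MellinConvergent, Finset.smul_sum] using! integrable_finsetSum t hg
  · simpa only [mellin, Finset.smul_sum] using! integral_finsetSum t hg

/-- The meromorphic continuation of `𝓕(s) / s` to `Re s > κ₀`. -/
noncomputable def quotientExt (f : ℕ → ℂ) (κ : ℂ) (q : ℝ) (m : ℕ) (Φ : ℕ → ℝ → ℂ) (s : ℂ) : ℂ :=
  mellin (indicator (Ioi 1) (summatoryError f κ q m Φ)) (-s) +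
    ∑ k ∈ Finset.range m, ((Real.log q : ℂ) ^ k)⁻¹ * periodicMellinExt q (Φ k) k (κ - s)

theorem analyticAt_mellin_summatoryError (hc : ∀ k < m, Continuous (Φ k))
    (hO : summatoryError f κ q m Φ =O[atTop] fun x : ℝ => x ^ κ₀) {s : ℂ} (hs : κ₀ < s.re) :
    AnalyticAt ℂ (fun s => mellin (indicator (Ioi 1) (summatoryError f κ q m Φ)) (-s)) s := by
  refine DifferentiableOn.analyticAt (s := {s : ℂ | κ₀ < s.re}) (fun z hz => ?_)
    ((isOpen_Ioi.preimage continuous_re).mem_nhds hs)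
  have := (mellin_indicator_Ioi_one (locallyIntegrableOn_summatoryError hc) hO (s := -z)
    (by simpa using hz)).2.differentiableAt
  exact (this.comp z differentiableAt_id.neg).differentiableWithinAt

theorem meromorphicAt_quotientExt (hq : 1 < q) (hc : ∀ k < m, Continuous (Φ k))
    (hO : summatoryError f κ q m Φ =O[atTop] fun x : ℝ => x ^ κ₀) {s : ℂ} (hs : κ₀ < s.re) :
    MeromorphicAt (quotientExt f κ q m Φ) s := by
  refine (analyticAt_mellin_summatoryError hc hO hs).meromorphicAt.add
    (MeromorphicAt.fun_sum fun k hk => (MeromorphicAt.const _ _).mul ?_)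
  exact (meromorphicAt_periodicMellinExt hq (hc k (Finset.mem_range.1 hk)) k (κ - s)).comp_analyticAt
    (g := fun s => κ - s) (analyticAt_const.sub analyticAt_id)

/-- A crude bound suffices for partial summation far to the right; the extra `1` absorbs the
logarithms. -/
theorem isBigO_sum_of_summatoryError (hΦper : ∀ k < m, Function.Periodic (Φ k) 1)
    (hc : ∀ k < m, Continuous (Φ k))
    (hO : summatoryError f κ q m Φ =O[atTop] fun x : ℝ => x ^ κ₀) :
    (fun n : ℕ => ∑ k ∈ Finset.Icc 1 n, f k) =O[atTop]
      fun n : ℕ => (n : ℝ) ^ (|κ₀| + |κ.re| + 1) := by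
  have h0 : (fun x : ℝ => x ^ κ₀) =O[atTop] fun x : ℝ => x ^ (|κ₀| + |κ.re| + 1) := by
    refine IsBigO.of_bound 1 ?_
    filter_upwards [eventually_ge_atTop 1] with x hx
    have hx0 : 0 < x := by linarith
    rw [Real.norm_of_nonneg (Real.rpow_nonneg hx0.le _),
      Real.norm_of_nonneg (Real.rpow_nonneg hx0.le _), one_mul]
    exact Real.rpow_le_rpow_of_exponent_le hx (by linarith [le_abs_self κ₀, abs_nonneg κ.re])
  have h1 : (fun x : ℝ => ∑ k ∈ Finset.range m, ((Real.log q : ℂ) ^ k)⁻¹ * ((x : ℂ) ^ κ *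
      ((Real.log x : ℂ) ^ k * Φ k (Real.logb q x)))) =O[atTop]
      fun x : ℝ => x ^ (|κ₀| + |κ.re| + 1) := by
    refine IsBigO.fun_sum fun k hk => IsBigO.const_mul_left (isBigO_cpow_mul_rpow
      (isBigO_log_pow_mul (hΦper k (Finset.mem_range.1 hk)) (hc k (Finset.mem_range.1 hk)) q k
        zero_lt_one) ?_) _
    linarith [le_abs_self κ.re, abs_nonneg κ₀]
  refine (((hO.trans h0).add h1).comp_tendsto tendsto_natCast_atTop_atTop).congr_left fun n => ?_
  simp [summatoryError]

theorem LSeries_eq_mul_quotientExt (hq : 1 < q) (hΦper : ∀ k < m, Function.Periodic (Φ k) 1)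
    (hc : ∀ k < m, Continuous (Φ k))
    (hO : summatoryError f κ q m Φ =O[atTop] fun x : ℝ => x ^ κ₀) {s : ℂ}
    (hs : |κ₀| + |κ.re| + 1 < s.re) (hS : LSeriesSummable f s) :
    LSeries f s = s * quotientExt f κ q m Φ s := by
  have hs0 : κ₀ < s.re := by linarith [le_abs_self κ₀, abs_nonneg κ.re]
  have hsκ : (κ - s).re < 0 := by
    rw [sub_re]; linarith [le_abs_self κ.re, abs_nonneg κ₀]
  rw [LSeries_eq_mul_integral f (by positivity) hs hS (isBigO_sum_of_summatoryError hΦper hc hO)]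
  congr 1
  have h1 : ∫ t in Ioi (1 : ℝ), (∑ k ∈ Finset.Icc 1 ⌊t⌋₊, f k) * (t : ℂ) ^ (-(s + 1)) =
      mellin (indicator (Ioi 1) fun x : ℝ => ∑ k ∈ Finset.Icc 1 ⌊x⌋₊, f k) (-s) := by
    rw [mellin, ← integral_indicator measurableSet_Ioi, ← integral_indicator measurableSet_Ioi]
    congr 1; ext x
    by_cases h1 : 1 < x
    · have : 0 < x := by linarith
      simp only [indicator_apply, mem_Ioi, h1, this, if_true, smul_eq_mul]
      rw [mul_comm]; congr 2; ring
    · simp [indicator_apply, h1]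
  set P : ℕ → ℝ → ℂ := fun k => indicator (Ioi 1) fun x : ℝ =>
    (Real.log x : ℂ) ^ k * Φ k (Real.logb q x) with hP
  have h2 : (indicator (Ioi 1) fun x : ℝ => ∑ k ∈ Finset.Icc 1 ⌊x⌋₊, f k) = fun x : ℝ =>
      indicator (Ioi 1) (summatoryError f κ q m Φ) x + ∑ k ∈ Finset.range m,
        ((Real.log q : ℂ) ^ k)⁻¹ • ((x : ℂ) ^ κ • P k x) := by
    ext x
    by_cases h1 : 1 < x
    · simp [hP, h1, summatoryError]
    · simp [hP, h1]
  have hPc : ∀ k ∈ Finset.range m, MellinConvergent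
      (fun x : ℝ => ((Real.log q : ℂ) ^ k)⁻¹ • ((x : ℂ) ^ κ • P k x)) (-s) := fun k hk =>
    (MellinConvergent.cpow_smul.2 (by
      rw [neg_add_eq_sub]
      exact mellinConvergent_log_pow_mul (hΦper k (Finset.mem_range.1 hk))
        (hc k (Finset.mem_range.1 hk)) k hsκ)).const_smul _
  have hsum := hasMellin_finset_sum _ hPc
  have hR := (mellin_indicator_Ioi_one (locallyIntegrableOn_summatoryError hc) hO (s := -s)
    (by simpa using hs0)).1
  rw [h1, h2, (hasMellin_add hR hsum.1).2, hsum.2, quotientExt]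
  congr 1
  refine Finset.sum_congr rfl fun k hk => ?_
  rw [mellin_const_smul, mellin_cpow_smul, smul_eq_mul, neg_add_eq_sub,
    periodicMellinExt_eq hq (hΦper k (Finset.mem_range.1 hk)) (hc k (Finset.mem_range.1 hk)) k hsκ]
  rfl

/-- Identity theorem: the difference is meromorphic on a connected half-plane and vanishes near a
point far to the right, so its order is `⊤` everywhere. -/
theorem eventually_eq_mul_quotientExt (hq : 1 < q) (hΦper : ∀ k < m, Function.Periodic (Φ k) 1)
    (hc : ∀ k < m, Continuous (Φ k))
    (hO : summatoryError f κ q m Φ =O[atTop] fun x : ℝ => x ^ κ₀) {σa : ℝ}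
    (hconv : ∀ s : ℂ, σa < s.re → LSeriesSummable f s) {𝓕 : ℂ → ℂ}
    (h𝓕 : ∀ s : ℂ, σa < s.re → 𝓕 s = LSeries f s)
    (hmero : MeromorphicOn 𝓕 {s : ℂ | κ₀ < s.re}) {a : ℂ} (ha : κ₀ < a.re) :
    ∀ᶠ s in 𝓝[≠] a, 𝓕 s = s * quotientExt f κ q m Φ s := by
  have hm : MeromorphicOn (fun s => 𝓕 s - s * quotientExt f κ q m Φ s) {s : ℂ | κ₀ < s.re} :=
    fun s hs => (hmero s hs).sub
      (analyticAt_id.meromorphicAt.mul (meromorphicAt_quotientExt hq hc hO hs))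
  have hpre : IsPreconnected {s : ℂ | κ₀ < s.re} := (convex_halfSpace_re_gt κ₀).isPreconnected
  set M : ℝ := max σa (|κ₀| + |κ.re| + 1) with hM
  set b : ℂ := ((M + 1 : ℝ) : ℂ) with hb
  have hbM : M < b.re := by simp [hb]
  have hb0 : κ₀ < b.re := by
    have := (le_max_right σa (|κ₀| + |κ.re| + 1)).trans_lt hbM
    linarith [le_abs_self κ₀, abs_nonneg κ.re]
  have htop : meromorphicOrderAt (fun s => 𝓕 s - s * quotientExt f κ q m Φ s) b = ⊤ := by
    rw [meromorphicOrderAt_eq_top_iff]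
    refine nhdsWithin_le_nhds ?_
    filter_upwards [(isOpen_Ioi.preimage continuous_re).mem_nhds hbM] with s hs
    have hs' : M < s.re := hs
    have h1 := (le_max_left _ _).trans_lt hs'
    rw [h𝓕 s h1, LSeries_eq_mul_quotientExt hq hΦper hc hO ((le_max_right _ _).trans_lt hs')
      (hconv s h1), sub_self]
  have : meromorphicOrderAt (fun s => 𝓕 s - s * quotientExt f κ q m Φ s) a = ⊤ := by
    by_contra h
    exact hm.meromorphicOrderAt_ne_top_of_isPreconnected hpre ha hb0 h htop
  filter_upwards [meromorphicOrderAt_eq_top_iff.1 this] with s hs using sub_eq_zero.1 hs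

/-! ### Fourier coefficients as residues. -/

theorem cpow_neg_chi (hq : 1 < q) (l : ℤ) : (q : ℂ) ^ (-chi q l) = 1 := by
  have hlog : (Real.log q : ℂ) ≠ 0 := by exact_mod_cast (Real.log_pos hq).ne'
  rw [cpow_def_of_ne_zero (by exact_mod_cast (by linarith : q ≠ 0)), ← ofReal_log (by linarith),
    Complex.exp_eq_one_iff]
  refine ⟨-l, ?_⟩
  rw [chi]
  push_cast
  field_simp

theorem fluctuationCoeff_eq_integral (hq : 1 < q) (hκ : κ₀ < κ.re)
    (hc : ∀ k < m, Continuous (Φ k))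
    (hO : summatoryError f κ q m Φ =O[atTop] fun x : ℝ => x ^ κ₀) {𝓕 : ℂ → ℂ}
    (h : ∀ a : ℂ, κ₀ < a.re → ∀ᶠ s in 𝓝[≠] a, 𝓕 s = s * quotientExt f κ q m Φ s)
    {k : ℕ} (hk : k < m) (l : ℤ) :
    fluctuationCoeff 𝓕 q κ k l = ∫ u in (0 : ℝ)..1,
      Φ k u * exp (-(2 * (l : ℂ) * (Real.pi : ℂ) * I * (u : ℂ))) := by
  have hlog : (Real.log q : ℂ) ≠ 0 := by exact_mod_cast (Real.log_pos hq).ne'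
  set a : ℂ := κ + chi q l with ha
  have hare : κ₀ < a.re := by
    have : (chi q l).re = 0 := by
      rw [chi, div_ofReal_re]; simp
    rw [ha, add_re, this]; linarith
  have hpp : ∀ j : ℕ, ∃ H : ℂ → ℂ, j < m → AnalyticAt ℂ H (-chi q l) ∧
      periodicMellinExt q (Φ j) j =ᶠ[𝓝[≠] (-chi q l)] fun w =>
        -(periodMellin q (Φ j) (-chi q l) / Real.log q) * ((-1) ^ j * j.factorial) *
          ((w - -chi q l) ^ (j + 1))⁻¹ + H w := fun j => by
    by_cases hj : j < m
    · obtain ⟨H, h1, h2⟩ := periodicMellinExt_principal_part (Φ := Φ j) hq (hc j hj) j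
        (cpow_neg_chi hq l)
      exact ⟨H, fun _ => ⟨h1, h2⟩⟩
    · exact ⟨0, fun h => absurd h hj⟩
  choose H hH using hpp
  -- No sign remains: the leading minus and the `(-1)^j` from differentiation cancel against `(-(s -
  -- a))^(j + 1)`.
  set b : ℕ → ℂ := fun j => ((Real.log q : ℂ) ^ j)⁻¹ *
    (periodMellin q (Φ j) (-chi q l) / Real.log q * j.factorial) with hb
  have hκa : κ - a = -chi q l := by rw [ha]; ring
  have hmap : Tendsto (fun s => κ - s) (𝓝[≠] a) (𝓝[≠] (-chi q l)) := by
    rw [← hκa]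
    refine tendsto_nhdsWithin_iff.2 ⟨(continuous_const.sub continuous_id).continuousAt.mono_left
      nhdsWithin_le_nhds, ?_⟩
    filter_upwards [self_mem_nhdsWithin] with s hs h
    exact hs (sub_right_injective h)
  have hev : ∀ᶠ s in 𝓝[≠] a, ∀ j ∈ Finset.range m, periodicMellinExt q (Φ j) j (κ - s) =
      -(periodMellin q (Φ j) (-chi q l) / Real.log q) * ((-1) ^ j * j.factorial) *
          ((κ - s - -chi q l) ^ (j + 1))⁻¹ + H j (κ - s) :=
    (Finset.eventually_all _).2 fun j hj => hmap.eventually (hH j (Finset.mem_range.1 hj)).2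
  -- The point `a` may itself be `0`, but the punctured neighbourhood then excludes it, and the
  -- factor `s` still cancels.
  have hne : ∀ᶠ s in 𝓝[≠] a, s ≠ 0 := by
    rcases eq_or_ne a 0 with h0 | h0
    · rw [h0]; exact self_mem_nhdsWithin
    · exact nhdsWithin_le_nhds (isOpen_ne.mem_nhds h0)
  have hres : residue (fun s : ℂ => 𝓕 s * (s - κ - chi q l) ^ k / s) a = b k := by
    refine residue_eq_of_principal_part hk b
      (h := fun s => mellin (indicator (Ioi 1) (summatoryError f κ q m Φ)) (-s) +
        ∑ j ∈ Finset.range m, ((Real.log q : ℂ) ^ j)⁻¹ * H j (κ - s)) ?_ ?_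
    · refine (analyticAt_mellin_summatoryError hc hO hare).add
        (Finset.analyticAt_fun_sum _ fun j hj => analyticAt_const.mul ?_)
      have h1 := (hH j (Finset.mem_range.1 hj)).1
      rw [← hκa] at h1
      exact h1.fun_comp (g := H j) (f := fun s => κ - s) (analyticAt_const.sub analyticAt_id)
    · filter_upwards [h a hare, hev, hne, self_mem_nhdsWithin] with s h1 h2 h3 h4
      have hsa : s - a ≠ 0 := sub_ne_zero.2 h4
      have e1 : s - κ - chi q l = s - a := by rw [ha]; ring
      have e2 : κ - s - -chi q l = -(s - a) := by rw [ha]; ring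
      have e3 : ∑ j ∈ Finset.range m,
          ((Real.log q : ℂ) ^ j)⁻¹ * periodicMellinExt q (Φ j) j (κ - s) =
          ∑ j ∈ Finset.range m, ((Real.log q : ℂ) ^ j)⁻¹ * H j (κ - s) +
          ∑ j ∈ Finset.range m, b j * ((s - a) ^ (j + 1))⁻¹ := by
        rw [← Finset.sum_add_distrib]
        refine Finset.sum_congr rfl fun j hj => ?_
        have e4 : (-1 : ℂ) ^ j * ((-(s - a)) ^ (j + 1))⁻¹ = -((s - a) ^ (j + 1))⁻¹ := by
          rw [neg_pow (s - a), mul_inv, ← mul_assoc, pow_succ (-1 : ℂ), mul_inv, ← mul_assoc,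
            mul_inv_cancel₀ (pow_ne_zero _ (by norm_num))]
          norm_num
        rw [h2 j hj, e2, hb]
        linear_combination ((Real.log q : ℂ) ^ j)⁻¹ *
          (-(periodMellin q (Φ j) (-chi q l) / Real.log q)) * j.factorial * e4
      rw [h1, e1, quotientExt, e3]
      field_simp
      ring
  have hkf : (k.factorial : ℂ) ≠ 0 := by exact_mod_cast k.factorial_ne_zero
  rw [fluctuationCoeff, hres, hb]
  simp only
  rw [periodMellin_eq_integral hq (hc k hk)]
  have : ∀ u : ℝ, exp (-chi q l * Real.log q * u) =
      exp (-(2 * (l : ℂ) * (Real.pi : ℂ) * I * (u : ℂ))) := fun u => by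
    rw [chi]; congr 1; field_simp
  simp only [this]
  field_simp

theorem analyticAt_quotientExt (hq : 1 < q) (hc : ∀ k < m, Continuous (Φ k))
    (hO : summatoryError f κ q m Φ =O[atTop] fun x : ℝ => x ^ κ₀) {s : ℂ} (hs : κ₀ < s.re)
    (hqs : (q : ℂ) ^ (κ - s) ≠ 1) : AnalyticAt ℂ (quotientExt f κ q m Φ) s := by
  refine (analyticAt_mellin_summatoryError hc hO hs).add
    (Finset.analyticAt_fun_sum _ fun j hj => analyticAt_const.mul ?_)
  exact (periodicMellinExt_analyticAt hq (hc j (Finset.mem_range.1 hj)) j hqs).fun_comp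
    (f := fun s => κ - s) (analyticAt_const.sub analyticAt_id)

end

/-! ### The main theorem. -/

theorem theoremA5
    (f : ℕ → ℂ) (κ₀ : ℝ) (κ : ℂ) (δ q : ℝ) (m : ℕ)
    (hκ₀_ne : κ₀ ≠ 0) (hκ₀ : -1 < κ₀) (hκ : κ₀ < κ.re)
    (hδ : 0 < δ) (hq : 1 < q)
    (hδq : δ ≤ Real.pi / Real.log q) (hδκ : δ < κ.re - κ₀)
    (hm : 0 < m)
    (α : NNReal) (hα : κ.re - κ₀ < (α : ℝ)) (hα1 : α ≤ 1)
    (Φ : ℕ → ℝ → ℂ)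
    (hΦper : ∀ k < m, Function.Periodic (Φ k) 1)
    (hΦhol : ∀ k < m, ∃ C : NNReal, HolderWith C α (Φ k))
    -- the asymptotic expansion of the summatory function, for integers `N → ∞`
    (hF : Asymptotics.IsBigO Filter.atTop
      (fun N : ℕ => (∑ n ∈ Finset.Ico 1 N, f n) -
        ∑ k ∈ Finset.range m, (N : ℂ) ^ κ * ((Real.logb q N : ℝ) : ℂ) ^ k *
          Φ k (Int.fract (Real.logb q N)))
      (fun N : ℕ => (N : ℝ) ^ κ₀))
    -- absolute convergence of the Dirichlet series for `Re s > σa`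
    (σa : ℝ) (hσa : κ.re ≤ σa)
    (hconv : ∀ s : ℂ, σa < s.re → LSeriesSummable f s)
    -- the meromorphic continuation to `Re s > κ₀ - δ`
    (𝓕 : ℂ → ℂ)
    (h𝓕 : ∀ s : ℂ, σa < s.re → 𝓕 s = LSeries f s)
    (hmero : MeromorphicOn 𝓕 {s : ℂ | κ₀ - δ < s.re})
    (hanalytic : ∀ s : ℂ, κ₀ - δ < s.re → (∀ l : ℤ, s ≠ κ + chi q l) → AnalyticAt ℂ 𝓕 s)
    (horder : ∀ l : ℤ, ((-(m : ℤ) : ℤ) : WithTop ℤ) ≤ meromorphicOrderAt 𝓕 (κ + chi q l))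
    -- polynomial growth away from the possible poles, as `|Im s| → ∞`
    (η : ℝ) (hη : 0 < η)
    (hgrowth : ∃ C T : ℝ, ∀ s : ℂ, κ₀ ≤ s.re → s.re ≤ σa →
      (∀ l : ℤ, δ ≤ ‖s - κ - chi q l‖) → T ≤ |s.im| → ‖𝓕 s‖ ≤ C * |s.im| ^ η) :
    -- `Φ_k` is the pointwise sum of its Fourier series, with the given coefficients
    (∀ k < m,
      (∀ l : ℤ, (∫ u in (0 : ℝ)..1,
          Φ k u * Complex.exp (-(2 * (l : ℂ) * (Real.pi : ℂ) * Complex.I * (u : ℂ)))) =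
        fluctuationCoeff 𝓕 q κ k l) ∧
      ∀ u : ℝ, Filter.Tendsto
        (fun L : ℕ => ∑ l ∈ Finset.Icc (-(L : ℤ)) (L : ℤ),
          fluctuationCoeff 𝓕 q κ k l *
            Complex.exp (2 * (l : ℂ) * (Real.pi : ℂ) * Complex.I * (u : ℂ)))
        Filter.atTop (nhds (Φ k u))) ∧
    (κ₀ < 0 → (∀ l : ℤ, κ ≠ 2 * (Real.pi : ℂ) * Complex.I / (Real.log q : ℂ) * (l : ℂ)) →
      𝓕 0 = 0) := by
  have hα0 : 0 < α := by
    have : (0 : ℝ) < α := by linarith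
    exact_mod_cast this
  have hc : ∀ k < m, Continuous (Φ k) := fun k hk =>
    let ⟨_, hC⟩ := hΦhol k hk
    hC.continuous hα0
  have hO := isBigO_summatoryError hq hκ hα hα1 hΦper hΦhol hF
  have hev : ∀ a : ℂ, κ₀ < a.re → ∀ᶠ s in 𝓝[≠] a, 𝓕 s = s * quotientExt f κ q m Φ s :=
    fun a ha => eventually_eq_mul_quotientExt hq hΦper hc hO hconv h𝓕
      (hmero.mono_set fun s (hs : κ₀ < s.re) => show κ₀ - δ < s.re by linarith) ha
  refine ⟨fun k hk => ?_, fun hneg hκχ => ?_⟩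
  · have hcoeff := fun l => fluctuationCoeff_eq_integral hq hκ hc hO hev hk l
    refine ⟨fun l => (hcoeff l).symm, fun u => ?_⟩
    obtain ⟨C, hC⟩ := hΦhol k hk
    simp only [hcoeff]
    exact tendsto_fourier_of_holder (hΦper k hk) hα0 hC u
  · have hlog : (Real.log q : ℂ) ≠ 0 := by exact_mod_cast (Real.log_pos hq).ne'
    -- The condition on `κ` keeps `0` away from the zeros of `1 - q^(κ - s)`.
    have hqκ : (q : ℂ) ^ (κ - 0) ≠ 1 := by
      rw [sub_zero, cpow_def_of_ne_zero (by exact_mod_cast (by linarith : q ≠ 0)),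
        ← ofReal_log (by linarith), Ne, Complex.exp_eq_one_iff]
      rintro ⟨n, hn⟩
      refine hκχ n ?_
      field_simp
      linear_combination hn
    have h1 : AnalyticAt ℂ 𝓕 0 := by
      refine hanalytic 0 (by simp; linarith) fun l hl => hκχ (-l) ?_
      rw [chi] at hl
      push_cast
      linear_combination -hl
    have h2 := analyticAt_quotientExt hq hc hO (s := 0) (by simpa using hneg) hqκ
    have t1 := h1.continuousAt.tendsto.mono_left (nhdsWithin_le_nhds (s := {0}ᶜ))
    have t2 := (analyticAt_id.mul h2).continuousAt.tendsto.mono_left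
      (nhdsWithin_le_nhds (s := {0}ᶜ))
    -- The identity holds only off `0`; continuity of both sides transfers it to `0`.
    have := tendsto_nhds_unique (t1.congr' (hev 0 (by simpa using hneg))) t2
    simpa using this
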